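/- Let $p\ge 1$ and $n\ge 2$, let $\boldsymbol\mu\in\mathbb R^p$, let $\boldsymbol\Sigma=(\sigma_{ij})$ be a real symmetric positive definite $p\times p$ matrix, and let $g:[0,\infty)\to[0,\infty)$ be measurable. Let $\mathcal E_p(\boldsymbol\mu,\boldsymbol\Sigma,g)$ be the elliptical distribution on $\mathbb R^p$ with Lebesgue density $$f(\mathbf x)=C_{p,g}\,|\boldsymbol\Sigma|^{-1/2}\,g\big((\mathbf x-\boldsymbol\mu)^\top\boldsymbol\Sigma^{-1}(\mathbf x-\boldsymbol\mu)\big),$$ where $C_{p,g}$ is the normalizing constant for which $f$ integrates to $1$, and where $g$ is scaled so that $\boldsymbol\Sigma$ is the covariance matrix of the distribution. Let $\mathbf x_1,\dots,\mathbf x_n$ be an i.i.d. sample from $\mathcal E_p(\boldsymbol\mu,\boldsymbol\Sigma,g)$ and assume that this distribution has finite fourth-order moments. Put $\bar{\mathbf x}=\frac1n\sum_{i=1}^n\mathbf x_i$ and $$\mathbf S=\frac1{n-1}\sum_{i=1}^n(\mathbf x_i-\bar{\mathbf x})(\mathbf x_i-\bar{\mathbf x})^\top,\qquad \kappa=\frac{\mathbb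 E[r^4]}{p(p+2)}-1\ \text{ with } r=\|\boldsymbol\Sigma^{-1/2}(\mathbf x_1-\boldsymbol\mu)\|,\qquad \tau_1=\frac1{n-1}+\frac{\kappa}{n},\qquad \tau_2=\frac{\kappa}{n}.$$ Let $\mathbf W=(w_{ij})$ be any real symmetric $p\times p$ matrix with $w_{ii}=1$ and $w_{ij}\ge 0$ for all $i,j$. Write $\circ$ for the entrywise product, $\|\mathbf A\|_{\mathrm F}^2=\operatorname{tr}(\mathbf A^\top\mathbf A)$, and $\mathbf D_{\mathbf A}=\operatorname{diag}(a_{11},\dots,a_{pp})$ for $\mathbf A=(a_{ij})$. Then the two expectations below are finite and $$\mathbb E\big[\|\mathbf W\circ\mathbf S\|_{\mathrm F}^2\big]=(1+\tau_1+\tau_2)\,\|\mathbf W\circ\boldsymbol\Sigma\|_{\mathrm F}^2+\tau_1\operatorname{tr}\big((\mathbf D_{\boldsymbol\Sigma}\mathbf W)^2\big),$$ $$\mathbb E\big[\operatorname{tr}\big((\mathbf D_{\mathbf S}\mathbf W)^2\big)\big]=2\tau_1\,\|\mathbf W\circ\boldsymbol\Sigma\|_{\mathrm F}^2+(1+\tau_2)\operatorname{tr}\big((\mathbf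 D_{\boldsymbol\Sigma}\mathbf W)^2\big).$$ -/

import Mathlib

open MeasureTheory ProbabilityTheory Matrix
open scoped NNReal ENNReal MatrixOrder

noncomputable section

/-- The quadratic form `(x - μ)ᵀ Σ⁻¹ (x - μ)`. -/
def mahalanobisSq {p : ℕ} (μ : Fin p → ℝ) (Sig : Matrix (Fin p) (Fin p) ℝ) (x : Fin p → ℝ) : ℝ :=
  (x - μ) ⬝ᵥ (Sig⁻¹ *ᵥ (x - μ))

/-- The elliptical density `x ↦ C |Σ|^(-1/2) g((x - μ)ᵀ Σ⁻¹ (x - μ))` with density generator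
`g : [0, ∞) → [0, ∞)` and constant `C`. -/
def ellipticalDensity {p : ℕ} (C : ℝ≥0) (μ : Fin p → ℝ) (Sig : Matrix (Fin p) (Fin p) ℝ)
    (g : ℝ≥0 → ℝ≥0) (x : Fin p → ℝ) : ℝ :=
  C * Sig.det ^ (-(1 / 2) : ℝ) * g (mahalanobisSq μ Sig x).toNNReal

/-- `ν` is the elliptical distribution `E_p(μ, Σ, g)`: a probability measure on `ℝ^p` which has the
elliptical density with respect to Lebesgue measure (since the total mass is one, `C` is the
normalizing constant), where `Σ` is positive definite symmetric and `g` is scaled in such a way that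
`Σ` is the covariance matrix of `ν`. -/
structure IsElliptical {p : ℕ} (ν : Measure (Fin p → ℝ)) (μ : Fin p → ℝ)
    (Sig : Matrix (Fin p) (Fin p) ℝ) (g : ℝ≥0 → ℝ≥0) : Prop where
  posDef : Sig.PosDef
  measurable_generator : Measurable g
  isProbabilityMeasure : IsProbabilityMeasure ν
  density : ∃ C : ℝ≥0,
    ν = volume.withDensity (fun x => ENNReal.ofReal (ellipticalDensity C μ Sig g x))
  covariance_eq : ∀ i j, cov[fun x => x i, fun x => x j; ν] = Sig i j

/-- The radius `r = ‖Σ^(-1/2) (x - μ)‖` (Euclidean norm, positive definite square root). -/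
def ellipticalRadius {p : ℕ} (μ : Fin p → ℝ) (Sig : Matrix (Fin p) (Fin p) ℝ)
    (x : Fin p → ℝ) : ℝ :=
  ‖WithLp.toLp 2 ((CFC.sqrt Sig)⁻¹ *ᵥ (x - μ))‖

/-- The elliptical kurtosis `κ = E[r⁴] / (p (p + 2)) - 1`. -/
def ellipticalKurtosis {p : ℕ} (ν : Measure (Fin p → ℝ)) (μ : Fin p → ℝ)
    (Sig : Matrix (Fin p) (Fin p) ℝ) : ℝ :=
  (∫ x, ellipticalRadius μ Sig x ^ 4 ∂ν) / ((p : ℝ) * ((p : ℝ) + 2)) - 1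

/-- The set `W⁺` of symmetric matrices with nonnegative entries and unit diagonal. -/
def taperSet (p : ℕ) : Set (Matrix (Fin p) (Fin p) ℝ) :=
  {W | W.IsSymm ∧ (∀ i, W i i = 1) ∧ ∀ i j, 0 ≤ W i j}

/-- The sample mean of `x₁, …, xₙ`. -/
def sampleMean {n p : ℕ} (x : Fin n → Fin p → ℝ) : Fin p → ℝ :=
  (1 / (n : ℝ)) • ∑ i, x i

/-- The unbiased sample covariance matrix of `x₁, …, xₙ` (for `n ≥ 2`). -/
def sampleCovariance {n p : ℕ} (x : Fin n → Fin p → ℝ) : Matrix (Fin p) (Fin p) ℝ :=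
  (1 / ((n : ℝ) - 1)) • ∑ i, vecMulVec (x i - sampleMean x) (x i - sampleMean x)

/-- The squared Frobenius norm `tr(Aᵀ A)`. -/
def frobeniusSq {p : ℕ} (A : Matrix (Fin p) (Fin p) ℝ) : ℝ :=
  (Aᵀ * A).trace

/-- The diagonal matrix `D_A` with the same diagonal as `A`. -/
def diagPart {p : ℕ} (A : Matrix (Fin p) (Fin p) ℝ) : Matrix (Fin p) (Fin p) ℝ :=
  Matrix.diagonal A.diag

/-- `τ₁ = 1 / (n - 1) + κ / n`. -/
def tau1 (n : ℕ) (κ : ℝ) : ℝ := 1 / ((n : ℝ) - 1) + κ / n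

/-- `τ₂ = κ / n`. -/
def tau2 (n : ℕ) (κ : ℝ) : ℝ := κ / n

end

/-!
Write `y = x - μ`. A linear involution which preserves the quadratic form of `Σ⁻¹` preserves the
elliptical distribution. The map `y ↦ -y` shows that `μ` is the mean, hence `E[yᵢ yⱼ] = Σᵢⱼ`.
Reflections act transitively on the vectors `u` with a given value of `uᵀ Σ u`, so
`E[(uᵀ y)⁴] = c (uᵀ Σ u)²` for a constant `c`. Polarizing, and evaluating `E[r⁴]` on the rows of
`Σ^(-1/2)` to identify the constant, gives `E[yᵢ² yⱼ²] = (1 + κ) (Σᵢᵢ Σⱼⱼ + 2 Σᵢⱼ²)`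
(`IsElliptical.integral_sq_mul_sq`). No polar coordinates are needed.

The sample covariance is the quadratic form `Sᵢⱼ = ∑ H a b yₐᵢ y_bⱼ` with
`H = (I - 𝟙𝟙ᵀ / n) / (n - 1)`.
By independence, a mixed fourth moment of centered observations is a sum over the three pairings of
its indices plus a fourth cumulant (`integral_mul_mul_mul_of_centered`). As `tr H = 1`,
`tr H² = 1 / (n - 1)` and `∑ H a a² = 1 / n`, this yields `E[Sᵢⱼ Sₖₗ]`
(`IsElliptical.integral_sampleCovariance_mul`). Both expectations are sums, with weights `wᵢⱼ²`, of
such moments: of `Sᵢⱼ²` for the first and of `Sᵢᵢ Sⱼⱼ` for the second.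
-/

/-! ### Invariance of Lebesgue measure and integrability -/

theorem MeasureTheory.MeasurePreserving.withDensity_of_comp_eq {α : Type*} [MeasurableSpace α]
    {m : Measure α} {T : α → α} (hT : MeasurePreserving T m m) {f : α → ℝ≥0∞} (hf : Measurable f)
    (h : ∀ x, f (T x) = f x) : MeasurePreserving T (m.withDensity f) (m.withDensity f) := by
  refine ⟨hT.measurable, ?_⟩
  ext s hs
  rw [Measure.map_apply hT.measurable hs, withDensity_apply _ (hT.measurable hs),
    withDensity_apply _ hs, ← hT.setLIntegral_comp_preimage hs hf]
  simp only [h]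

/-- An involutive matrix has determinant `±1`, so it preserves Lebesgue measure. -/
theorem measurePreserving_affine_of_involution {p : ℕ} (μ : Fin p → ℝ)
    (M : Matrix (Fin p) (Fin p) ℝ) (hM : M * M = 1) :
    MeasurePreserving (fun x : Fin p → ℝ => μ + M *ᵥ (x - μ)) volume volume := by
  have hdet : M.det * M.det = 1 := by rw [← det_mul, hM, det_one]
  have habs : |M.det| = 1 := by
    rcases mul_self_eq_one_iff.1 hdet with h | h <;> simp [h]
  have hlin : MeasurePreserving (toLin' M) (volume : Measure (Fin p → ℝ)) volume := by
    refine ⟨(toLin' M).continuous_of_finiteDimensional.measurable, ?_⟩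
    rw [Real.map_matrix_volume_pi_eq_smul_volume_pi (left_ne_zero_of_mul_eq_one hdet), abs_inv,
      habs]
    simp
  have := (measurePreserving_add_left volume μ).comp
    (hlin.comp (measurePreserving_sub_right volume μ))
  exact this

theorem measurable_mahalanobisSq {p : ℕ} (μ : Fin p → ℝ) (Sig : Matrix (Fin p) (Fin p) ℝ) :
    Measurable (mahalanobisSq μ Sig) := by
  apply Continuous.measurable
  unfold mahalanobisSq
  fun_prop

/-- AM-GM without the optimal constant: enough to dominate a product of four `L⁴` functions. -/
theorem abs_mul_mul_mul_le_sum_pow_four (a b c d : ℝ) :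
    |a * b * c * d| ≤ a ^ 4 + b ^ 4 + c ^ 4 + d ^ 4 := by
  rw [abs_le]
  constructor <;>
  nlinarith [sq_nonneg (a * b + c * d), sq_nonneg (a * b - c * d), sq_nonneg (a ^ 2 - b ^ 2),
    sq_nonneg (c ^ 2 - d ^ 2), sq_nonneg (a ^ 2), sq_nonneg (b ^ 2), sq_nonneg (c ^ 2),
    sq_nonneg (d ^ 2)]

theorem MeasureTheory.MemLp.integrable_mul_mul_mul {α : Type*} [MeasurableSpace α]
    {m : Measure α} {a b c d : α → ℝ} (ha : MemLp a 4 m) (hb : MemLp b 4 m) (hc : MemLp c 4 m)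
    (hd : MemLp d 4 m) : Integrable (fun x => a x * b x * c x * d x) m := by
  have key {f : α → ℝ} (hf : MemLp f 4 m) : Integrable (fun x => f x ^ 4) m := by
    have := MemLp.integrable_norm_pow (p := 4) (by exact_mod_cast hf) (by norm_num)
    refine this.congr (.of_forall fun x => ?_)
    simp [(by decide : Even 4).pow_abs]
  refine Integrable.mono' (((key ha).add (key hb)).add (key hc) |>.add (key hd))
    (((ha.1.mul hb.1).mul hc.1).mul hd.1) (.of_forall fun x => ?_)
  exact abs_mul_mul_mul_le_sum_pow_four _ _ _ _

/-! ### Second and fourth moments of an elliptical distribution -/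

namespace IsElliptical

variable {p : ℕ} {ν : Measure (Fin p → ℝ)} {μ : Fin p → ℝ} {Sig : Matrix (Fin p) (Fin p) ℝ}
  {g : ℝ≥0 → ℝ≥0}

/-- The only symmetry used below: a linear involution about `μ` which preserves the quadratic form of
`Σ⁻¹` preserves the elliptical distribution. -/
theorem measurePreserving_of_involution (hν : IsElliptical ν μ Sig g)
    {M : Matrix (Fin p) (Fin p) ℝ} (hM : M * M = 1)
    (hinv : ∀ y, (M *ᵥ y) ⬝ᵥ (Sig⁻¹ *ᵥ (M *ᵥ y)) = y ⬝ᵥ (Sig⁻¹ *ᵥ y)) :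
    MeasurePreserving (fun x : Fin p → ℝ => μ + M *ᵥ (x - μ)) ν ν := by
  obtain ⟨C, rfl⟩ := hν.density
  have hm := measurable_mahalanobisSq μ Sig
  have hg := hν.measurable_generator
  refine MeasurePreserving.withDensity_of_comp_eq
    (measurePreserving_affine_of_involution μ M hM) ?_ fun x => ?_
  · unfold ellipticalDensity
    fun_prop
  · simp only [ellipticalDensity, mahalanobisSq, add_sub_cancel_left, hinv]

theorem dotProduct_inv_mulVec (hν : IsElliptical ν μ Sig g) (d y : Fin p → ℝ) :
    (Sig *ᵥ d) ⬝ᵥ (Sig⁻¹ *ᵥ y) = d ⬝ᵥ y := by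
  have hu : IsUnit Sig.det := hν.posDef.det_pos.ne'.isUnit
  have hs : Sigᵀ = Sig := by simpa using hν.posDef.isHermitian.eq
  rw [← hs, mulVec_transpose, ← dotProduct_mulVec, mulVec_mulVec, hs,
    Matrix.mul_nonsing_inv _ hu, one_mulVec]

theorem dotProduct_mulVec_symm (hν : IsElliptical ν μ Sig g) (u v : Fin p → ℝ) :
    u ⬝ᵥ (Sig *ᵥ v) = v ⬝ᵥ (Sig *ᵥ u) := by
  have hs : Sigᵀ = Sig := by simpa using hν.posDef.isHermitian.eq
  conv_lhs => rw [← hs, mulVec_transpose, dotProduct_comm, ← dotProduct_mulVec]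

theorem dotProduct_mulVec_pos (hν : IsElliptical ν μ Sig g) {u : Fin p → ℝ} (hu : u ≠ 0) :
    0 < u ⬝ᵥ (Sig *ᵥ u) := by
  simpa using hν.posDef.dotProduct_mulVec_pos hu

theorem memLp_dotProduct (hν : IsElliptical ν μ Sig g)
    (hmom : ∀ j, MemLp (fun x : Fin p → ℝ => x j) 4 ν) (u : Fin p → ℝ) :
    MemLp (fun x => u ⬝ᵥ (x - μ)) 4 ν := by
  have := hν.isProbabilityMeasure
  simp only [dotProduct, Pi.sub_apply]
  exact memLp_finsetSum _ fun j _ => ((hmom j).sub (memLp_const _)).const_mul _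

/-- The point reflection about `μ` preserves `ν`, so odd moments vanish. -/
theorem integral_dotProduct (hν : IsElliptical ν μ Sig g) (u : Fin p → ℝ) :
    ∫ x, u ⬝ᵥ (x - μ) ∂ν = 0 := by
  have hT := hν.measurePreserving_of_involution (M := -1) (by simp)
    (by simp [neg_mulVec, mulVec_neg])
  have h := hT.hasLaw.integral_comp (f := fun x => u ⬝ᵥ (x - μ)) (by
    apply Continuous.aestronglyMeasurable; fun_prop)
  simp only [Function.comp_def, add_sub_cancel_left, neg_mulVec, one_mulVec, dotProduct_neg,
    integral_neg] at h
  linarith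

theorem integral_coord (hν : IsElliptical ν μ Sig g)
    (hmom : ∀ j, MemLp (fun x : Fin p → ℝ => x j) 4 ν) (j : Fin p) :
    ∫ x, x j ∂ν = μ j := by
  have := hν.isProbabilityMeasure
  have h := hν.integral_dotProduct (Pi.single j 1)
  simp only [single_one_dotProduct, Pi.sub_apply] at h
  rw [integral_sub ((hmom j).integrable (by norm_num)) (integrable_const _)] at h
  simp at h
  linarith

theorem integral_mul_coord (hν : IsElliptical ν μ Sig g)
    (hmom : ∀ j, MemLp (fun x : Fin p → ℝ => x j) 4 ν) (i j : Fin p) :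
    ∫ x, (x i - μ i) * (x j - μ j) ∂ν = Sig i j := by
  rw [← hν.covariance_eq i j, covariance, hν.integral_coord hmom, hν.integral_coord hmom]

/-- The fourth moment of `uᵀ(x - μ)` depends on `u` through `uᵀ Σ u` only: if `uᵀ Σ u = vᵀ Σ v`, the
reflection along `u - v` in the inner product of `Σ` swaps `u` and `v`, and its transpose preserves
`ν`. -/
theorem integral_dotProduct_pow_four_eq (hν : IsElliptical ν μ Sig g) {u v : Fin p → ℝ}
    (huv : u ⬝ᵥ (Sig *ᵥ u) = v ⬝ᵥ (Sig *ᵥ v)) :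
    ∫ x, (u ⬝ᵥ (x - μ)) ^ 4 ∂ν = ∫ x, (v ⬝ᵥ (x - μ)) ^ 4 ∂ν := by
  rcases eq_or_ne u v with rfl | hne
  · rfl
  set d := u - v with hd
  have hq : 0 < d ⬝ᵥ (Sig *ᵥ d) := hν.dotProduct_mulVec_pos (sub_ne_zero.2 hne)
  set q := d ⬝ᵥ (Sig *ᵥ d) with hqdef
  -- `M` is the transpose of the `Σ`-reflection `w ↦ w - 2 (dᵀ Σ w / dᵀ Σ d) d`.
  set M : Matrix (Fin p) (Fin p) ℝ := 1 - (2 / q) • vecMulVec (Sig *ᵥ d) d with hMdef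
  have hMy (y : Fin p → ℝ) : M *ᵥ y = y - (2 / q * (d ⬝ᵥ y)) • (Sig *ᵥ d) := by
    rw [hMdef, sub_mulVec, one_mulVec, smul_mulVec, vecMulVec_mulVec]
    ext i; simp; ring
  have hMM : M * M = 1 := by
    apply Matrix.ext_of_mulVec_single
    intro i
    rw [← mulVec_mulVec, hMy, hMy, one_mulVec]
    ext j
    simp [dotProduct_sub, dotProduct_smul, ← hqdef]
    field_simp
    ring
  have hinv (y : Fin p → ℝ) : (M *ᵥ y) ⬝ᵥ (Sig⁻¹ *ᵥ (M *ᵥ y)) = y ⬝ᵥ (Sig⁻¹ *ᵥ y) := by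
    have hu : IsUnit Sig.det := hν.posDef.det_pos.ne'.isUnit
    have h1 : Sig⁻¹ *ᵥ (Sig *ᵥ d) = d := by
      rw [mulVec_mulVec, Matrix.nonsing_inv_mul _ hu, one_mulVec]
    rw [hMy]
    simp only [mulVec_sub, mulVec_smul, h1, dotProduct_sub, sub_dotProduct, dotProduct_smul,
      smul_dotProduct, smul_eq_mul, hν.dotProduct_inv_mulVec, dotProduct_comm y d]
    rw [dotProduct_comm _ d, ← hqdef]
    field_simp
    ring
  have hT := hν.measurePreserving_of_involution hMM hinv
  have h := hT.hasLaw.integral_comp (f := fun x => (u ⬝ᵥ (x - μ)) ^ 4) (by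
    apply Continuous.aestronglyMeasurable; fun_prop)
  rw [← h]
  congr 1 with x
  -- This is where `uᵀ Σ u = vᵀ Σ v` enters; it says that the reflection sends `u` to `v`.
  have h2 : 2 * (u ⬝ᵥ (Sig *ᵥ d)) = q := by
    rw [hqdef, hd]
    simp only [mulVec_sub, dotProduct_sub, sub_dotProduct]
    rw [huv, hν.dotProduct_mulVec_symm v u]
    ring
  have h3 : 2 / q * (u ⬝ᵥ (Sig *ᵥ d)) = 1 := by
    field_simp
    exact h2
  rw [Function.comp_apply, add_sub_cancel_left, hMy]
  have h4 : 2 / q * d ⬝ᵥ (x - μ) * u ⬝ᵥ (Sig *ᵥ d) = u ⬝ᵥ (x - μ) - v ⬝ᵥ (x - μ) := by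
    rw [← sub_dotProduct, ← hd]
    linear_combination (d ⬝ᵥ (x - μ)) * h3
  rw [dotProduct_sub, dotProduct_smul, smul_eq_mul, h4]
  ring

/-- By homogeneity, the fourth moment of `uᵀ(x - μ)` is a constant multiple of `(uᵀ Σ u)²`. -/
theorem exists_integral_dotProduct_pow_four (hν : IsElliptical ν μ Sig g) :
    ∃ c, ∀ u : Fin p → ℝ, ∫ x, (u ⬝ᵥ (x - μ)) ^ 4 ∂ν = c * (u ⬝ᵥ (Sig *ᵥ u)) ^ 2 := by
  by_cases h0 : ∃ e : Fin p → ℝ, e ≠ 0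
  · obtain ⟨e, he⟩ := h0
    have hqe := hν.dotProduct_mulVec_pos he
    refine ⟨(∫ x, (e ⬝ᵥ (x - μ)) ^ 4 ∂ν) / (e ⬝ᵥ (Sig *ᵥ e)) ^ 2, fun u => ?_⟩
    rcases eq_or_ne u 0 with rfl | hu
    · simp
    have hqu := hν.dotProduct_mulVec_pos hu
    set s := √((u ⬝ᵥ (Sig *ᵥ u)) / (e ⬝ᵥ (Sig *ᵥ e))) with hs
    have hs2 : s ^ 2 = (u ⬝ᵥ (Sig *ᵥ u)) / (e ⬝ᵥ (Sig *ᵥ e)) := Real.sq_sqrt (by positivity)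
    rw [hν.integral_dotProduct_pow_four_eq (u := u) (v := s • e)]
    · simp only [smul_dotProduct, smul_eq_mul, mul_pow]
      rw [integral_const_mul, show s ^ 4 = (s ^ 2) ^ 2 by ring, hs2]
      field_simp
    · simp only [smul_dotProduct, smul_eq_mul, mulVec_smul, dotProduct_smul]
      rw [← mul_assoc, ← sq, hs2]
      field_simp
  · push Not at h0
    refine ⟨0, fun u => ?_⟩
    rw [h0 u]
    simp

/-- Polarization of `exists_integral_dotProduct_pow_four`. The constant is identified as `1 + κ` in
`integral_sq_mul_sq`. -/
theorem exists_integral_sq_mul_sq (hν : IsElliptical ν μ Sig g)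
    (hmom : ∀ j, MemLp (fun x : Fin p → ℝ => x j) 4 ν) :
    ∃ c, ∀ u v : Fin p → ℝ, ∫ x, (u ⬝ᵥ (x - μ)) ^ 2 * (v ⬝ᵥ (x - μ)) ^ 2 ∂ν =
      c * ((u ⬝ᵥ (Sig *ᵥ u)) * (v ⬝ᵥ (Sig *ᵥ v)) + 2 * (u ⬝ᵥ (Sig *ᵥ v)) ^ 2) := by
  obtain ⟨c, hc⟩ := hν.exists_integral_dotProduct_pow_four
  refine ⟨c / 3, fun u v => ?_⟩
  have hi (w : Fin p → ℝ) : Integrable (fun x => (w ⬝ᵥ (x - μ)) ^ 4) ν := by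
    have h := hν.memLp_dotProduct hmom w
    refine (h.integrable_mul_mul_mul h h h).congr (.of_forall fun x => ?_)
    ring
  -- `(a + b)⁴ + (a - b)⁴ = 2 a⁴ + 12 a² b² + 2 b⁴`
  have hpol (x : Fin p → ℝ) : (u ⬝ᵥ (x - μ)) ^ 2 * (v ⬝ᵥ (x - μ)) ^ 2 =
      (1 / 12) * (((u + v) ⬝ᵥ (x - μ)) ^ 4 + ((u - v) ⬝ᵥ (x - μ)) ^ 4
        - 2 * (u ⬝ᵥ (x - μ)) ^ 4 - 2 * (v ⬝ᵥ (x - μ)) ^ 4) := by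
    rw [add_dotProduct, sub_dotProduct]
    ring
  simp only [hpol]
  rw [integral_const_mul, integral_sub, integral_sub, integral_add (hi _) (hi _),
    integral_const_mul, integral_const_mul, hc, hc, hc, hc]
  · simp only [mulVec_add, mulVec_sub, dotProduct_add, dotProduct_sub, add_dotProduct,
      sub_dotProduct, hν.dotProduct_mulVec_symm v u]
    ring
  · exact (hi _).add (hi _)
  · exact (hi _).const_mul _
  · exact ((hi _).add (hi _)).sub ((hi _).const_mul _)
  · exact (hi _).const_mul _

/-- The fourth power of the radius in terms of the linear forms given by the rows of `Σ^(-1/2)`, which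
are orthonormal for the inner product of `Σ`. -/
theorem exists_ellipticalRadius_pow_four (hν : IsElliptical ν μ Sig g) :
    ∃ A : Fin p → Fin p → ℝ, (∀ i j, A i ⬝ᵥ (Sig *ᵥ A j) = (1 : Matrix (Fin p) (Fin p) ℝ) i j) ∧
      ∀ x, ellipticalRadius μ Sig x ^ 4 =
        ∑ i, ∑ j, (A i ⬝ᵥ (x - μ)) ^ 2 * (A j ⬝ᵥ (x - μ)) ^ 2 := by
  have hnn : (0 : Matrix (Fin p) (Fin p) ℝ) ≤ Sig := hν.posDef.posSemidef.nonneg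
  set R := CFC.sqrt Sig with hR
  have hRR : R * R = Sig := CFC.sqrt_mul_sqrt_self Sig hnn
  have hRT : Rᵀ = R := by
    simpa using (Matrix.nonneg_iff_posSemidef.1 (CFC.sqrt_nonneg Sig)).isHermitian.eq
  have hRu : IsUnit R.det := by
    rw [isUnit_iff_ne_zero]
    intro h0
    have := hν.posDef.det_pos
    rw [← hRR, det_mul, h0] at this
    simp at this
  refine ⟨fun i => R⁻¹ i, fun i j => ?_, fun x => ?_⟩
  · have : R⁻¹ * Sig * R⁻¹ᵀ = 1 := by
      rw [transpose_nonsing_inv, hRT, ← hRR, ← Matrix.mul_assoc, Matrix.nonsing_inv_mul _ hRu,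
        Matrix.one_mul, Matrix.mul_nonsing_inv _ hRu]
    rw [← this, Matrix.mul_assoc]
    rfl
  · have h2 : ellipticalRadius μ Sig x ^ 2 = ∑ i, (R⁻¹ i ⬝ᵥ (x - μ)) ^ 2 := by
      rw [ellipticalRadius, EuclideanSpace.real_norm_sq_eq]
      rfl
    rw [show ellipticalRadius μ Sig x ^ 4 = (ellipticalRadius μ Sig x ^ 2) ^ 2 by ring, h2, sq,
      Finset.sum_mul_sum]

/-- Summing `c (1 + 2 δᵢⱼ)` over all `i, j` gives `c (p² + 2 p)`. -/
theorem integral_ellipticalRadius_pow_four (hν : IsElliptical ν μ Sig g)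
    (hmom : ∀ j, MemLp (fun x : Fin p → ℝ => x j) 4 ν) {c : ℝ}
    (hc : ∀ u v : Fin p → ℝ, ∫ x, (u ⬝ᵥ (x - μ)) ^ 2 * (v ⬝ᵥ (x - μ)) ^ 2 ∂ν =
      c * ((u ⬝ᵥ (Sig *ᵥ u)) * (v ⬝ᵥ (Sig *ᵥ v)) + 2 * (u ⬝ᵥ (Sig *ᵥ v)) ^ 2)) :
    ∫ x, ellipticalRadius μ Sig x ^ 4 ∂ν = c * (p * (p + 2)) := by
  obtain ⟨A, hA, hr⟩ := hν.exists_ellipticalRadius_pow_four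
  have hi (u v : Fin p → ℝ) :
      Integrable (fun x => (u ⬝ᵥ (x - μ)) ^ 2 * (v ⬝ᵥ (x - μ)) ^ 2) ν := by
    have hu := hν.memLp_dotProduct hmom u
    have hv := hν.memLp_dotProduct hmom v
    refine (hu.integrable_mul_mul_mul hu hv hv).congr (.of_forall fun x => ?_)
    ring
  simp only [hr]
  rw [integral_finsetSum _ fun i _ => integrable_finsetSum _ fun j _ => hi _ _]
  have hs (i : Fin p) : ∫ x, ∑ j, (A i ⬝ᵥ (x - μ)) ^ 2 * (A j ⬝ᵥ (x - μ)) ^ 2 ∂ν =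
      c * (p + 2) := by
    rw [integral_finsetSum _ fun j _ => hi _ _]
    simp only [hc, hA, ← Finset.mul_sum, Finset.sum_add_distrib, one_apply]
    simp
  simp only [hs]
  simp
  ring

theorem integral_sq_mul_sq (hν : IsElliptical ν μ Sig g)
    (hmom : ∀ j, MemLp (fun x : Fin p → ℝ => x j) 4 ν) (i j : Fin p) :
    ∫ x, (x i - μ i) ^ 2 * (x j - μ j) ^ 2 ∂ν =
      (1 + ellipticalKurtosis ν μ Sig) * (Sig i i * Sig j j + 2 * Sig i j ^ 2) := by
  obtain ⟨c, hc⟩ := hν.exists_integral_sq_mul_sq hmom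
  have hp : (0 : ℝ) < p := by exact_mod_cast (i.pos)
  have hκ : 1 + ellipticalKurtosis ν μ Sig = c := by
    rw [ellipticalKurtosis, hν.integral_ellipticalRadius_pow_four hmom hc]
    field_simp
    ring
  rw [hκ]
  simpa using hc (Pi.single i 1) (Pi.single j 1)

end IsElliptical

/-! ### Mixed fourth moments of an independent sample and the centering matrix -/

section Sample

variable {Ω E ι : Type*} [MeasurableSpace Ω] [MeasurableSpace E] {P : Measure Ω}
  {ν : Measure E} {X : ι → Ω → E}

/-- A centered factor whose index differs from the three others makes the mixed moment vanish. -/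
theorem integral_mul_eq_zero_of_isolated (hindep : iIndepFun X P)
    (hlaw : ∀ i, HasLaw (X i) ν P) {f₁ f₂ f₃ f₄ : E → ℝ} (h₁ : Measurable f₁)
    (h₂ : Measurable f₂) (h₃ : Measurable f₃) (h₄ : Measurable f₄) (hf : ∫ x, f₁ x ∂ν = 0)
    {a b c d : ι} (hb : a ≠ b) (hc : a ≠ c) (hd : a ≠ d) :
    ∫ ω, f₁ (X a ω) * (f₂ (X b ω) * f₃ (X c ω) * f₄ (X d ω)) ∂P = 0 := by
  classical
  have hX (i : ι) : AEMeasurable (X i) P := (hlaw i).aemeasurable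
  have hI := hindep.indepFun_finset₀ {a} {b, c, d} (by simp [hb, hc, hd]) hX
  let φ : (({a} : Finset ι) → E) → ℝ := fun x => f₁ (x ⟨a, by simp⟩)
  let ψ : (({b, c, d} : Finset ι) → E) → ℝ := fun x =>
    f₂ (x ⟨b, by simp⟩) * f₃ (x ⟨c, by simp⟩) * f₄ (x ⟨d, by simp⟩)
  have hI' := hI.comp (φ := φ) (ψ := ψ) (by fun_prop) (by fun_prop)
  have h0 : ∫ ω, f₁ (X a ω) ∂P = 0 := by
    rw [← hf]
    exact (hlaw a).integral_comp h₁.aestronglyMeasurable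
  have := hI'.integral_fun_mul_eq_mul_integral
    (h₁.comp_aemeasurable (hX a)).aestronglyMeasurable
    (((h₂.comp_aemeasurable (hX b)).mul (h₃.comp_aemeasurable (hX c))).mul
      (h₄.comp_aemeasurable (hX d))).aestronglyMeasurable
  refine this.trans ?_
  change (∫ ω, f₁ (X a ω) ∂P) * _ = 0
  rw [h0, zero_mul]

theorem integral_mul_eq_mul_of_ne (hindep : iIndepFun X P)
    (hlaw : ∀ i, HasLaw (X i) ν P) {f₁ f₂ : E → ℝ} (h₁ : Measurable f₁)
    (h₂ : Measurable f₂) {a b : ι} (hab : a ≠ b) :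
    ∫ ω, f₁ (X a ω) * f₂ (X b ω) ∂P = (∫ x, f₁ x ∂ν) * ∫ x, f₂ x ∂ν := by
  have hX (i : ι) : AEMeasurable (X i) P := (hlaw i).aemeasurable
  rw [← (hlaw a).integral_comp h₁.aestronglyMeasurable,
    ← (hlaw b).integral_comp h₂.aestronglyMeasurable]
  exact ((hindep.indepFun hab).comp h₁ h₂).integral_fun_mul_eq_mul_integral
    (h₁.comp_aemeasurable (hX a)).aestronglyMeasurable
    (h₂.comp_aemeasurable (hX b)).aestronglyMeasurable

/-- Mixed fourth moments of centered functions of an i.i.d. sample: one term for each of the three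
pairings of the four indices, plus a fourth cumulant when all the indices agree. When they do agree,
all four conditions hold and the three pairing terms cancel. -/
theorem integral_mul_mul_mul_of_centered [DecidableEq ι] (hindep : iIndepFun X P)
    (hlaw : ∀ i, HasLaw (X i) ν P) {f₁ f₂ f₃ f₄ : E → ℝ} (h₁ : Measurable f₁)
    (h₂ : Measurable f₂) (h₃ : Measurable f₃) (h₄ : Measurable f₄) (e₁ : ∫ x, f₁ x ∂ν = 0)
    (e₂ : ∫ x, f₂ x ∂ν = 0) (e₃ : ∫ x, f₃ x ∂ν = 0) (e₄ : ∫ x, f₄ x ∂ν = 0) (a b c d : ι) :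
    ∫ ω, f₁ (X a ω) * f₂ (X b ω) * f₃ (X c ω) * f₄ (X d ω) ∂P =
      (if a = b ∧ c = d then (∫ x, f₁ x * f₂ x ∂ν) * ∫ x, f₃ x * f₄ x ∂ν else 0)
      + (if a = c ∧ b = d then (∫ x, f₁ x * f₃ x ∂ν) * ∫ x, f₂ x * f₄ x ∂ν else 0)
      + (if a = d ∧ b = c then (∫ x, f₁ x * f₄ x ∂ν) * ∫ x, f₂ x * f₃ x ∂ν else 0)
      + (if a = b ∧ b = c ∧ c = d then (∫ x, f₁ x * f₂ x * f₃ x * f₄ x ∂ν)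
          - (∫ x, f₁ x * f₂ x ∂ν) * (∫ x, f₃ x * f₄ x ∂ν)
          - (∫ x, f₁ x * f₃ x ∂ν) * (∫ x, f₂ x * f₄ x ∂ν)
          - (∫ x, f₁ x * f₄ x ∂ν) * (∫ x, f₂ x * f₃ x ∂ν) else 0) := by
  by_cases hab : a = b
  · subst hab
    by_cases hcd : c = d
    · subst hcd
      by_cases hac : a = c
      · subst hac
        have h := (hlaw a).integral_comp (f := fun x => f₁ x * f₂ x * f₃ x * f₄ x)
          (by fun_prop)
        simp only [Function.comp_def] at h
        simp only [and_self, if_true, h]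
        ring
      · simp only [hac, and_self, and_true, and_false, if_true, if_false, add_zero]
        refine Eq.trans ?_ (integral_mul_eq_mul_of_ne hindep hlaw (h₁.mul h₂) (h₃.mul h₄) hac)
        congr 1 with ω
        simp only [Pi.mul_apply]
        ring
    · by_cases hac : a = c
      · -- `d` is isolated
        subst hac
        simp only [hcd, and_false, and_true, if_false, add_zero]
        rw [← integral_mul_eq_zero_of_isolated hindep hlaw h₄ h₁ h₂ h₃ e₄
          (Ne.symm hcd) (Ne.symm hcd) (Ne.symm hcd)]
        congr 1 with ω
        ring
      · -- `c` is isolated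
        simp only [hac, hcd, and_false, false_and, if_false, add_zero]
        rw [← integral_mul_eq_zero_of_isolated hindep hlaw h₃ h₁ h₂ h₄ e₃
          (Ne.symm hac) (Ne.symm hac) hcd]
        congr 1 with ω
        ring
  · by_cases hac : a = c
    · subst hac
      by_cases hbd : b = d
      · subst hbd
        simp only [hab, and_self, false_and, if_true, if_false, add_zero, zero_add]
        refine Eq.trans ?_ (integral_mul_eq_mul_of_ne hindep hlaw (h₁.mul h₃) (h₂.mul h₄) hab)
        congr 1 with ω
        simp only [Pi.mul_apply]
        ring
      · -- `b` is isolated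
        simp only [hab, Ne.symm hab, hbd, and_false, false_and, if_false, add_zero]
        rw [← integral_mul_eq_zero_of_isolated hindep hlaw h₂ h₁ h₃ h₄ e₂
          (Ne.symm hab) (Ne.symm hab) hbd]
        congr 1 with ω
        ring
    · by_cases had : a = d
      · subst had
        by_cases hbc : b = c
        · subst hbc
          simp only [hab, and_self, false_and, if_true, if_false, add_zero, zero_add]
          refine Eq.trans ?_ (integral_mul_eq_mul_of_ne hindep hlaw (h₁.mul h₄) (h₂.mul h₃) hab)
          congr 1 with ω
          simp only [Pi.mul_apply]
          ring
        · -- `b` is isolated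
          simp only [hab, hac, hbc, and_false, false_and, if_false, add_zero]
          rw [← integral_mul_eq_zero_of_isolated hindep hlaw h₂ h₁ h₃ h₄ e₂
            (Ne.symm hab) hbc (Ne.symm hab)]
          congr 1 with ω
          ring
      · -- `a` is isolated
        simp only [hab, hac, had, false_and, if_false, add_zero]
        rw [← integral_mul_eq_zero_of_isolated hindep hlaw h₁ h₂ h₃ h₄ e₁ hab hac had]
        congr 1 with ω
        ring

/-- Contraction of `H ⊗ H` with the index pattern of `integral_mul_mul_mul_of_centered`. -/
theorem sum_mul_mul_pairing_ite [Fintype ι] [DecidableEq ι] (H : ι → ι → ℝ) (s₁ s₂ s₃ s₄ : ℝ) :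
    ∑ a, ∑ b, ∑ c, ∑ d, H a b * H c d *
      ((if a = b ∧ c = d then s₁ else 0) + (if a = c ∧ b = d then s₂ else 0)
        + (if a = d ∧ b = c then s₃ else 0) + (if a = b ∧ b = c ∧ c = d then s₄ else 0)) =
      (∑ a, H a a) ^ 2 * s₁ + (∑ a, ∑ b, H a b * H a b) * s₂ + (∑ a, ∑ b, H a b * H b a) * s₃
        + (∑ a, H a a * H a a) * s₄ := by
  simp only [mul_add, Finset.sum_add_distrib]
  congr 1
  · congr 1
    · congr 1
      · rw [sq, Finset.sum_mul_sum]
        simp [ite_and, Finset.sum_mul]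
      · simp [ite_and, Finset.sum_mul]
    · simp [ite_and, Finset.sum_mul]
  · simp [ite_and, Finset.sum_mul]

/-- The scaled centering matrix `(I - 𝟙𝟙ᵀ / n) / (n - 1)`, given by its entries; it is the coefficient
matrix of the sample covariance as a quadratic form in the observations. -/
noncomputable def centeringMatrix (n : ℕ) (a b : Fin n) : ℝ :=
  (1 / ((n : ℝ) - 1)) * ((if a = b then 1 else 0) - 1 / n)

/-- The sample covariance is translation invariant, so the observations may be centered at any `μ`. -/
theorem sampleCovariance_apply {n p : ℕ} (hn : n ≠ 0) (x : Fin n → Fin p → ℝ) (μ : Fin p → ℝ)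
    (i j : Fin p) :
    sampleCovariance x i j =
      ∑ a, ∑ b, centeringMatrix n a b * ((x a i - μ i) * (x b j - μ j)) := by
  have hn' : (n : ℝ) ≠ 0 := by exact_mod_cast hn
  have hmean (k : Fin p) (a : Fin n) : x a k - sampleMean x k =
      (x a k - μ k) - (1 / n) * ∑ b, (x b k - μ k) := by
    simp [sampleMean, Finset.sum_sub_distrib]
    field_simp
    ring
  have hl : sampleCovariance x i j =
      (1 / ((n : ℝ) - 1)) * ∑ a, (x a i - sampleMean x i) * (x a j - sampleMean x j) := by
    simp [sampleCovariance, Matrix.sum_apply, vecMulVec_apply]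
  rw [hl]
  simp only [hmean, centeringMatrix]
  generalize hy : (fun a k => x a k - μ k) = y
  have hy' (a k) : x a k - μ k = y a k := by rw [← hy]
  simp only [hy', mul_assoc, ← Finset.mul_sum]
  congr 1
  simp only [sub_mul, mul_sub, Finset.sum_sub_distrib, ite_mul, one_mul, zero_mul,
    Finset.sum_ite_eq, Finset.mem_univ, if_true, ← Finset.mul_sum, ← Finset.sum_mul,
    Finset.sum_const, Finset.card_univ, Fintype.card_fin, nsmul_eq_mul]
  field_simp
  ring

theorem sum_centeringMatrix_diag {n : ℕ} (hn : 2 ≤ n) : ∑ a, centeringMatrix n a a = 1 := by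
  have h1 : (n : ℝ) - 1 ≠ 0 := by
    have : (2 : ℝ) ≤ n := by exact_mod_cast hn
    linarith
  have h0 : (n : ℝ) ≠ 0 := by positivity
  simp [centeringMatrix]
  field_simp

theorem sum_centeringMatrix_diag_sq {n : ℕ} (hn : 2 ≤ n) :
    ∑ a, centeringMatrix n a a * centeringMatrix n a a = 1 / n := by
  have h1 : (n : ℝ) - 1 ≠ 0 := by
    have : (2 : ℝ) ≤ n := by exact_mod_cast hn
    linarith
  have h0 : (n : ℝ) ≠ 0 := by positivity
  simp [centeringMatrix]
  field_simp

theorem centeringMatrix_symm {n : ℕ} (a b : Fin n) :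
    centeringMatrix n a b = centeringMatrix n b a := by
  simp only [centeringMatrix, eq_comm]

/-- `I - 𝟙𝟙ᵀ / n` is a projection of rank `n - 1`. -/
theorem sum_centeringMatrix_sq {n : ℕ} (hn : 2 ≤ n) :
    ∑ a, ∑ b, centeringMatrix n a b * centeringMatrix n a b = 1 / ((n : ℝ) - 1) := by
  have h1 : (n : ℝ) - 1 ≠ 0 := by
    have : (2 : ℝ) ≤ n := by exact_mod_cast hn
    linarith
  have h0 : (n : ℝ) ≠ 0 := by positivity
  have (a b : Fin n) : centeringMatrix n a b * centeringMatrix n a b =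
      (1 / ((n : ℝ) - 1)) ^ 2 * ((if a = b then 1 - 2 / (n : ℝ) else 0) + 1 / (n : ℝ) ^ 2) := by
    simp only [centeringMatrix]
    split_ifs <;> ring
  simp only [this, ← Finset.mul_sum, Finset.sum_add_distrib, Finset.sum_ite_eq, Finset.mem_univ,
    if_true, Finset.sum_const, Finset.card_univ, Fintype.card_fin, nsmul_eq_mul]
  field_simp
  ring

end Sample

/-! ### Moments of the sample covariance and the weighted sums -/

section Moments

variable {Ω : Type*} [MeasurableSpace Ω] {P : Measure Ω}
  {n p : ℕ} {μ : Fin p → ℝ} {Sig : Matrix (Fin p) (Fin p) ℝ} {g : ℝ≥0 → ℝ≥0}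
  {ν : Measure (Fin p → ℝ)} {X : Fin n → Ω → Fin p → ℝ}

theorem sampleCovariance_mul_sampleCovariance (hn : 2 ≤ n) (μ : Fin p → ℝ)
    (x : Fin n → Fin p → ℝ) (i j k l : Fin p) :
    sampleCovariance x i j * sampleCovariance x k l =
      ∑ a, ∑ b, ∑ c, ∑ d, centeringMatrix n a b * centeringMatrix n c d *
        ((x a i - μ i) * (x b j - μ j) * (x c k - μ k) * (x d l - μ l)) := by
  rw [sampleCovariance_apply (by lia) x μ i j, sampleCovariance_apply (by lia) x μ k l]
  simp only [Finset.sum_mul]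
  simp only [Finset.mul_sum]
  refine Finset.sum_congr rfl fun a _ => Finset.sum_congr rfl fun b _ =>
    Finset.sum_congr rfl fun c _ => Finset.sum_congr rfl fun d _ => ?_
  ring

theorem IsElliptical.memLp_sample (hν : IsElliptical ν μ Sig g)
    (hmom : ∀ j, MemLp (fun x : Fin p → ℝ => x j) 4 ν) (hlaw : ∀ i, HasLaw (X i) ν P)
    (a : Fin n) (j : Fin p) : MemLp (fun ω => X a ω j - μ j) 4 P := by
  have := hν.isProbabilityMeasure
  have h : MemLp (fun x : Fin p → ℝ => x j - μ j) 4 ν := (hmom j).sub (memLp_const _)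
  rw [← (hlaw a).map_eq] at h
  exact (memLp_map_measure_iff h.1 (hlaw a).aemeasurable).1 h

theorem IsElliptical.integrable_sampleCovariance_mul (hn : 2 ≤ n) (hν : IsElliptical ν μ Sig g)
    (hmom : ∀ j, MemLp (fun x : Fin p → ℝ => x j) 4 ν) (hlaw : ∀ i, HasLaw (X i) ν P)
    (i j k l : Fin p) :
    Integrable (fun ω => sampleCovariance (fun a => X a ω) i j *
      sampleCovariance (fun a => X a ω) k l) P := by
  simp only [sampleCovariance_mul_sampleCovariance hn μ]
  have h := hν.memLp_sample hmom hlaw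
  exact integrable_finsetSum _ fun a _ => integrable_finsetSum _ fun b _ =>
    integrable_finsetSum _ fun c _ => integrable_finsetSum _ fun d _ =>
      ((h a i).integrable_mul_mul_mul (h b j) (h c k) (h d l)).const_mul _

/-- `E[Sᵢⱼ Sₖₗ]`: the diagonal sum `1` of the centering matrix weights the pairing `(ij)(kl)`, its squared
Frobenius norm `1 / (n - 1)` the two other pairings, and its squared diagonal, with sum `1 / n`, the
fourth cumulant. -/
theorem IsElliptical.integral_sampleCovariance_mul (hn : 2 ≤ n) (hν : IsElliptical ν μ Sig g)
    (hmom : ∀ j, MemLp (fun x : Fin p → ℝ => x j) 4 ν) (hindep : iIndepFun X P)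
    (hlaw : ∀ i, HasLaw (X i) ν P) (i j k l : Fin p) :
    ∫ ω, sampleCovariance (fun a => X a ω) i j * sampleCovariance (fun a => X a ω) k l ∂P =
      Sig i j * Sig k l + (1 / ((n : ℝ) - 1)) * (Sig i k * Sig j l + Sig i l * Sig j k)
      + (1 / (n : ℝ)) * ((∫ x, (x i - μ i) * (x j - μ j) * (x k - μ k) * (x l - μ l) ∂ν)
        - Sig i j * Sig k l - Sig i k * Sig j l - Sig i l * Sig j k) := by
  have h := hν.memLp_sample hmom hlaw
  have hi (a b c d : Fin n) : Integrable (fun ω => centeringMatrix n a b * centeringMatrix n c d *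
      ((X a ω i - μ i) * (X b ω j - μ j) * (X c ω k - μ k) * (X d ω l - μ l))) P :=
    ((h a i).integrable_mul_mul_mul (h b j) (h c k) (h d l)).const_mul _
  have hm (j : Fin p) : Measurable fun x : Fin p → ℝ => x j - μ j := by fun_prop
  have h0 (j : Fin p) : ∫ x, (x j - μ j) ∂ν = 0 := by
    simpa using hν.integral_dotProduct (Pi.single j 1)
  have hprod (a b c d : Fin n) := integral_mul_mul_mul_of_centered hindep hlaw
    (hm i) (hm j) (hm k) (hm l) (h0 i) (h0 j) (h0 k) (h0 l) a b c d
  simp only [hν.integral_mul_coord hmom] at hprod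
  simp only [sampleCovariance_mul_sampleCovariance hn μ]
  rw [integral_finsetSum _ fun a _ => integrable_finsetSum _ fun b _ =>
    integrable_finsetSum _ fun c _ => integrable_finsetSum _ fun d _ => hi a b c d]
  have hsum (a : Fin n) := integral_finsetSum Finset.univ fun b _ =>
    integrable_finsetSum Finset.univ fun c _ => integrable_finsetSum Finset.univ
      fun d _ => hi a b c d
  have hsum' (a b : Fin n) := integral_finsetSum Finset.univ fun c _ =>
    integrable_finsetSum Finset.univ fun d _ => hi a b c d
  have hsum'' (a b c : Fin n) := integral_finsetSum Finset.univ fun d _ => hi a b c d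
  simp only [hsum, hsum', hsum'', integral_const_mul, hprod]
  rw [sum_mul_mul_pairing_ite]
  have hsymm : ∑ a : Fin n, ∑ b, centeringMatrix n a b * centeringMatrix n b a =
      1 / ((n : ℝ) - 1) := by
    rw [← sum_centeringMatrix_sq hn]
    simp only [fun a b => centeringMatrix_symm (n := n) b a]
  rw [sum_centeringMatrix_diag hn, sum_centeringMatrix_diag_sq hn, sum_centeringMatrix_sq hn, hsymm]
  ring

theorem IsElliptical.integral_sampleCovariance_sq (hn : 2 ≤ n) (hν : IsElliptical ν μ Sig g)
    (hmom : ∀ j, MemLp (fun x : Fin p → ℝ => x j) 4 ν) (hindep : iIndepFun X P)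
    (hlaw : ∀ i, HasLaw (X i) ν P) (i j : Fin p) :
    ∫ ω, sampleCovariance (fun a => X a ω) i j * sampleCovariance (fun a => X a ω) i j ∂P =
      (1 + tau1 n (ellipticalKurtosis ν μ Sig) + tau2 n (ellipticalKurtosis ν μ Sig)) *
        Sig i j ^ 2 + tau1 n (ellipticalKurtosis ν μ Sig) * (Sig i i * Sig j j) := by
  rw [hν.integral_sampleCovariance_mul hn hmom hindep hlaw]
  have hs : Sig j i = Sig i j := by
    simpa using congrFun (congrFun hν.posDef.isHermitian.eq i) j
  have h4 : ∫ x, (x i - μ i) * (x j - μ j) * (x i - μ i) * (x j - μ j) ∂ν =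
      (1 + ellipticalKurtosis ν μ Sig) * (Sig i i * Sig j j + 2 * Sig i j ^ 2) := by
    rw [← hν.integral_sq_mul_sq hmom]
    congr 1 with x
    ring
  rw [h4, tau1, tau2, hs]
  ring

theorem IsElliptical.integral_sampleCovariance_diag (hn : 2 ≤ n) (hν : IsElliptical ν μ Sig g)
    (hmom : ∀ j, MemLp (fun x : Fin p → ℝ => x j) 4 ν) (hindep : iIndepFun X P)
    (hlaw : ∀ i, HasLaw (X i) ν P) (i j : Fin p) :
    ∫ ω, sampleCovariance (fun a => X a ω) i i * sampleCovariance (fun a => X a ω) j j ∂P =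
      2 * tau1 n (ellipticalKurtosis ν μ Sig) * Sig i j ^ 2 +
        (1 + tau2 n (ellipticalKurtosis ν μ Sig)) * (Sig i i * Sig j j) := by
  rw [hν.integral_sampleCovariance_mul hn hmom hindep hlaw]
  have h4 : ∫ x, (x i - μ i) * (x i - μ i) * (x j - μ j) * (x j - μ j) ∂ν =
      (1 + ellipticalKurtosis ν μ Sig) * (Sig i i * Sig j j + 2 * Sig i j ^ 2) := by
    rw [← hν.integral_sq_mul_sq hmom]
    congr 1 with x
    ring
  rw [h4, tau1, tau2]
  ring

theorem frobeniusSq_hadamard (W A : Matrix (Fin p) (Fin p) ℝ) :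
    frobeniusSq (W ⊙ A) = ∑ j, ∑ i, W i j ^ 2 * (A i j * A i j) := by
  simp only [frobeniusSq, trace, diag_apply, mul_apply, transpose_apply, hadamard_apply]
  refine Finset.sum_congr rfl fun j _ => Finset.sum_congr rfl fun i _ => ?_
  ring

theorem trace_diagPart_mul_sq {W : Matrix (Fin p) (Fin p) ℝ} (hW : W.IsSymm)
    (A : Matrix (Fin p) (Fin p) ℝ) :
    ((diagPart A * W) ^ 2).trace = ∑ j, ∑ i, W i j ^ 2 * (A i i * A j j) := by
  simp only [diagPart, sq, trace, diag_apply, mul_apply (M := diagonal _ * W), diagonal_mul]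
  refine Finset.sum_congr rfl fun j _ => Finset.sum_congr rfl fun i _ => ?_
  rw [hW.apply i j]
  ring

end Moments

theorem lemma1 {Ω : Type*} [MeasurableSpace Ω] (P : Measure Ω) [IsProbabilityMeasure P]
    {n p : ℕ} (hn : 2 ≤ n)
    (μ : Fin p → ℝ) (Sig : Matrix (Fin p) (Fin p) ℝ) (g : ℝ≥0 → ℝ≥0)
    (ν : Measure (Fin p → ℝ)) (hν : IsElliptical ν μ Sig g)
    (hmom : ∀ j, MemLp (fun x : Fin p → ℝ => x j) 4 ν)
    (X : Fin n → Ω → Fin p → ℝ) (hindep : iIndepFun X P) (hlaw : ∀ i, HasLaw (X i) ν P)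
    (W : Matrix (Fin p) (Fin p) ℝ) (hW : W ∈ taperSet p) :
    (Integrable (fun ω => frobeniusSq (W ⊙ sampleCovariance (fun i => X i ω))) P ∧
      ∫ ω, frobeniusSq (W ⊙ sampleCovariance (fun i => X i ω)) ∂P =
        (1 + tau1 n (ellipticalKurtosis ν μ Sig) + tau2 n (ellipticalKurtosis ν μ Sig)) *
            frobeniusSq (W ⊙ Sig) +
          tau1 n (ellipticalKurtosis ν μ Sig) * ((diagPart Sig * W) ^ 2).trace) ∧
    (Integrable (fun ω => ((diagPart (sampleCovariance (fun i => X i ω)) * W) ^ 2).trace) P ∧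
      ∫ ω, ((diagPart (sampleCovariance (fun i => X i ω)) * W) ^ 2).trace ∂P =
        2 * tau1 n (ellipticalKurtosis ν μ Sig) * frobeniusSq (W ⊙ Sig) +
          (1 + tau2 n (ellipticalKurtosis ν μ Sig)) * ((diagPart Sig * W) ^ 2).trace) := by
  have hi (i j k l : Fin p) (w : ℝ) := (hν.integrable_sampleCovariance_mul hn hmom hlaw
    i j k l).const_mul w
  simp only [frobeniusSq_hadamard, trace_diagPart_mul_sq hW.1]
  refine ⟨⟨integrable_finsetSum _ fun j _ => integrable_finsetSum _ fun i _ => hi _ _ _ _ _, ?_⟩,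
    integrable_finsetSum _ fun j _ => integrable_finsetSum _ fun i _ => hi _ _ _ _ _, ?_⟩
  · rw [integral_finsetSum _ fun j _ => integrable_finsetSum _ fun i _ => hi _ _ _ _ _,
      Finset.mul_sum, Finset.mul_sum, ← Finset.sum_add_distrib]
    refine Finset.sum_congr rfl fun j _ => ?_
    rw [integral_finsetSum _ fun i _ => hi _ _ _ _ _,
      Finset.mul_sum, Finset.mul_sum, ← Finset.sum_add_distrib]
    refine Finset.sum_congr rfl fun i _ => ?_
    rw [integral_const_mul, hν.integral_sampleCovariance_sq hn hmom hindep hlaw]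
    ring
  · rw [integral_finsetSum _ fun j _ => integrable_finsetSum _ fun i _ => hi _ _ _ _ _,
      Finset.mul_sum, Finset.mul_sum, ← Finset.sum_add_distrib]
    refine Finset.sum_congr rfl fun j _ => ?_
    rw [integral_finsetSum _ fun i _ => hi _ _ _ _ _,
      Finset.mul_sum, Finset.mul_sum, ← Finset.sum_add_distrib]
    refine Finset.sum_congr rfl fun i _ => ?_
    rw [integral_const_mul, hν.integral_sampleCovariance_diag hn hmom hindep hlaw]
    ring
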